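/- Let $C,n\in\mathbb{N}$, let $\mathcal{X}$ be a measurable space, let $f:\mathcal{X}\to\Delta_{C-1}=\{p\in[0,1]^C:\sum_c p_c=1\}$ be a measurable $C$-class classifier, let $\mathcal{D}$ be a probability distribution of labelled data $(x,y)$ with $x\in\mathcal{X}$ and $y$ one of the $C$ one-hot vectors in $\mathbb{R}^C$, and let $S$ be a data set of $|S|=n$ labelled points of this kind (repetitions allowed). For $Q\subseteq\mathbb{R}^{2C}$ put $$D(S,\mathcal{D}|Q)=\bigl|\mathbb{P}_{(x,y)\sim S}((f(x),y)\in Q)-\mathbb{P}_{(x,y)\sim\mathcal{D}}((f(x),y)\in Q)\bigr|,$$ where $(x,y)\sim S$ means uniformly distributed on $S$, and for a family $\mathcal{Q}$ of such sets put $D_{\mathcal{Q}}(S,\mathcal{D})=\sup_{Q\in\mathcal{Q}}D(S,\mathcal{D}|Q)$. Let $\mathcal{Q}'_{cvx}$ be the family of all closed convex subsets of $\mathbb{R}^{2C}$ and, for $K\in\mathbb{N}$, let $\mathcal{Q}'_{cvx,K}$ be the family of all closed convex (possibly unbounded) polytopes with at most $K$ facets, that is, of all sets $\{a\in\mathbb{R}^{2C}: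 w_i^\top a+b_i\le 0,\ i=1,\dots,K\}$ with $w_i\in\mathbb{R}^{2C}$, $b_i\in\mathbb{R}$. If $|S|\ge 4C$, then $$D_{\mathcal{Q}'_{cvx}}(S,\mathcal{D})=D_{\mathcal{Q}'_{cvx,K}}(S,\mathcal{D})\qquad\text{for } K=\binom{|S|}{2C}.$$ -/

import Mathlib

open MeasureTheory

namespace CvxDiscrepancy

/-- The ambient space `ℝ^{2C} = ℝ^C × ℝ^C` of pairs (predicted probabilities, label vector). -/
abbrev Ambient (C : ℕ) : Type := Fin C ⊕ Fin C → ℝ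

/-- The vector `(f(x), y) ∈ ℝ^{2C}` of a labelled point `z = (x, y)`, the label `y ∈ [C]` being
written in one-hot format. -/
def feature {X : Type*} {C : ℕ} (f : X → Fin C → ℝ) (z : X × Fin C) : Ambient C :=
  Sum.elim (f z.1) (Pi.single z.2 1)

/-- `ℙ_{(x, y) ∼ S}((f(x), y) ∈ Q)`, for `(x, y)` uniform on the data set `S` of size `n`
(a family, so repeated data points are counted with multiplicity). -/
noncomputable def sampleProb {X : Type*} {C n : ℕ} (f : X → Fin C → ℝ) (S : Fin n → X × Fin C)
    (Q : Set (Ambient C)) : ℝ :=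
  (Nat.card {i : Fin n // feature f (S i) ∈ Q} : ℝ) / (n : ℝ)

/-- `ℙ_{(x, y) ∼ 𝒟}((f(x), y) ∈ Q)`. -/
noncomputable def distProb {X : Type*} [MeasurableSpace X] {C : ℕ} (f : X → Fin C → ℝ)
    (𝒟 : Measure (X × Fin C)) (Q : Set (Ambient C)) : ℝ :=
  𝒟.real {z | feature f z ∈ Q}

/-- `D(S, 𝒟 | Q)`, the discrepancy between `S` and `𝒟` on a single set `Q`. -/
noncomputable def discrepancyOn {X : Type*} [MeasurableSpace X] {C n : ℕ} (f : X → Fin C → ℝ)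
    (S : Fin n → X × Fin C) (𝒟 : Measure (X × Fin C)) (Q : Set (Ambient C)) : ℝ :=
  |sampleProb f S Q - distProb f 𝒟 Q|

/-- The discrepancy distance `sup_{Q ∈ 𝒬} D(S, 𝒟 | Q)` with respect to a family `𝒬` of sets.
For a probability measure `𝒟` all the values lie in `[0, 1]`, so the supremum is a genuine one
for every non-empty `𝒬`. -/
noncomputable def discrepancy {X : Type*} [MeasurableSpace X] {C n : ℕ} (f : X → Fin C → ℝ)
    (S : Fin n → X × Fin C) (𝒟 : Measure (X × Fin C)) (𝒬 : Set (Set (Ambient C))) : ℝ :=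
  sSup (discrepancyOn f S 𝒟 '' 𝒬)

/-- All closed convex subsets of `ℝ^{2C}`. -/
def closedConvexSets (C : ℕ) : Set (Set (Ambient C)) :=
  {Q | IsClosed Q ∧ Convex ℝ Q}

/-- All closed convex polytopes in `ℝ^{2C}` with at most `K` facets, i.e. all sets
`{a | w_iᵀ a + b_i ≤ 0 for all i ∈ [K]}` with `w_i ∈ ℝ^{2C}` and `b_i ∈ ℝ`. -/
def closedConvexPolytopes (C K : ℕ) : Set (Set (Ambient C)) :=
  {Q | ∃ (w : Fin K → Ambient C) (b : Fin K → ℝ), Q = {a | ∀ i, w i ⬝ᵥ a + b i ≤ 0}}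

end CvxDiscrepancy

open Module

namespace CvxDiscrepancy

/-! A closed convex `Q` is replaced by a polytope with the same sample points and at least the same
discrepancy. If `𝒟` gives `Q` at least its sample frequency, enlarge `Q`: one separating half-space
per sample point outside. Otherwise shrink `Q` to the convex hull of its sample points.

To count the inequalities of the hull, lift the points to height one. A facet of the resulting cone,
of dimension `t`, is fixed by `t - 1` independent generators, and each equation of its span costs
two inequalities. Predictions and labels both sum to one, so the span has codimension at least two;
this slack and `n ≥ 4C` let `n.choose (2 * C)` absorb the equations. -/

/-! ### Facets of finitely generated cones -/

theorem exists_forall_smul_eq_of_finrank_le_one {W : Type*} [AddCommGroup W] [Module ℝ W]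
    [FiniteDimensional ℝ W] (p : Submodule ℝ W) (h : finrank ℝ p ≤ 1) :
    ∃ v : W, ∀ w ∈ p, ∃ c : ℝ, c • v = w := by
  obtain ⟨v, hv⟩ := finrank_le_one_iff.1 h
  refine ⟨v, fun w hw => ?_⟩
  obtain ⟨c, hc⟩ := hv ⟨w, hw⟩
  exact ⟨c, congrArg Subtype.val hc⟩

theorem exists_finset_card_le_finrank_span_eq {W : Type*} [AddCommGroup W] [Module ℝ W]
    [FiniteDimensional ℝ W] (p : Submodule ℝ W) :
    ∃ s : Finset W, s.card ≤ finrank ℝ p ∧ Submodule.span ℝ (s : Set W) = p := by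
  classical
  let B := finBasis ℝ p
  refine ⟨Finset.univ.image fun j => (B j : W), Finset.card_image_le.trans (by simp), ?_⟩
  have := congrArg (Submodule.map p.subtype) B.span_eq
  rw [Submodule.map_span, Submodule.map_top, Submodule.range_subtype, ← Set.range_comp] at this
  simpa [Function.comp_def] using this

/-- A functional that is nonnegative on a finite spanning family `a` and negative at `x` may be
chosen so that the members of `a` on which it vanishes span a hyperplane. -/
theorem exists_nonneg_functional_finrank_zeros {V ι : Type*} [AddCommGroup V] [Module ℝ V]
    [FiniteDimensional ℝ V] [Fintype ι] (a : ι → V) (ha : Submodule.span ℝ (Set.range a) = ⊤)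
    (x : V) (φ₀ : Dual ℝ V) (h₀ : ∀ i, 0 ≤ φ₀ (a i)) (hx₀ : φ₀ x < 0) :
    ∃ φ : Dual ℝ V, (∀ i, 0 ≤ φ (a i)) ∧ φ x < 0 ∧
      finrank ℝ V ≤ finrank ℝ (Submodule.span ℝ (a '' {i | φ (a i) = 0})) + 1 := by
  classical
  let zeros : Dual ℝ V → Finset ι := fun φ => Finset.univ.filter fun i => φ (a i) = 0
  let A : Set (Dual ℝ V) := {φ | (∀ i, 0 ≤ φ (a i)) ∧ φ x < 0}
  have hbdd : BddAbove ((fun φ => (zeros φ).card) '' A) :=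
    ⟨Fintype.card ι, by rintro _ ⟨φ, -, rfl⟩; exact Finset.card_le_univ _⟩
  obtain ⟨φ, ⟨hφ, hφx⟩, hmax⟩ : ∃ φ ∈ A, ∀ ψ ∈ A, (zeros ψ).card ≤ (zeros φ).card := by
    have hne : ((fun φ => (zeros φ).card) '' A).Nonempty := ⟨_, φ₀, ⟨h₀, hx₀⟩, rfl⟩
    obtain ⟨φ, hφ, hcard⟩ := Nat.sSup_mem hne hbdd
    refine ⟨φ, hφ, fun ψ hψ => ?_⟩
    have := le_csSup hbdd ⟨ψ, hψ, rfl⟩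
    simp only at hcard
    rw [hcard]
    exact this
  refine ⟨φ, hφ, hφx, ?_⟩
  -- If the zeros had codimension at least two, `φ` could be tilted about them to gain a zero,
  -- against maximality.
  by_contra! hlt
  set Z := Submodule.span ℝ (a '' {i | φ (a i) = 0}) with hZ
  -- a functional vanishing on the zeros of `φ` that is not a multiple of `φ`
  obtain ⟨ψ, hψZ, hψ⟩ : ∃ ψ ∈ Z.dualAnnihilator, ψ ∉ Submodule.span ℝ {φ} := by
    by_contra! hcon
    have h1 : finrank ℝ Z.dualAnnihilator ≤ finrank ℝ (Submodule.span ℝ {φ}) :=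
      Submodule.finrank_mono hcon
    have h2 := finrank_span_le_card (R := ℝ) ({φ} : Set (Dual ℝ V))
    have h3 := Subspace.finrank_add_finrank_dualAnnihilator_eq Z
    simp at h2
    omega
  have hψ0 : ∀ i, φ (a i) = 0 → ψ (a i) = 0 := fun i hi =>
    (Submodule.mem_dualAnnihilator _).1 hψZ _ (Submodule.subset_span ⟨i, hi, rfl⟩)
  -- a functional which moreover vanishes at `x` and is negative somewhere on `a`
  obtain ⟨χ, hχ0, hχx, j, hj⟩ : ∃ χ : Dual ℝ V, (∀ i, φ (a i) = 0 → χ (a i) = 0) ∧ χ x = 0 ∧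
      ∃ j, χ (a j) < 0 := by
    let χ : Dual ℝ V := ψ - (ψ x / φ x) • φ
    have hχ0 : ∀ i, φ (a i) = 0 → χ (a i) = 0 := fun i hi => by simp [χ, hi, hψ0 i hi]
    have hχx : χ x = 0 := by simp [χ, hφx.ne]
    have hne : ∃ j, χ (a j) ≠ 0 := by
      by_contra! hcon
      have : χ = 0 := LinearMap.ext_on ha (by rintro _ ⟨i, rfl⟩; simpa using hcon i)
      exact hψ (Submodule.mem_span_singleton.2 ⟨_, (sub_eq_zero.1 this).symm⟩)
    obtain ⟨j, hj⟩ := hne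
    rcases hj.lt_or_gt with hj | hj
    · exact ⟨χ, hχ0, hχx, j, hj⟩
    · exact ⟨-χ, fun i hi => by simp [hχ0 i hi], by simp [hχx], j, by simpa using hj⟩
  -- Ratio test: `s` is the first time at which `φ + s • χ` acquires a new zero, so no generator has
  -- become negative yet.
  obtain ⟨l, hl, hmin⟩ := Finset.exists_min_image (Finset.univ.filter fun i => χ (a i) < 0)
    (fun i => φ (a i) / -χ (a i)) ⟨j, by simpa using hj⟩
  simp only [Finset.mem_filter, Finset.mem_univ, true_and] at hl hmin
  set s := φ (a l) / -χ (a l) with hs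
  have hs0 : 0 ≤ s := div_nonneg (hφ l) (by linarith)
  have hmem : φ + s • χ ∈ A := by
    refine ⟨fun i => ?_, by simpa [hχx] using hφx⟩
    simp only [LinearMap.add_apply, LinearMap.smul_apply, smul_eq_mul]
    rcases lt_or_ge (χ (a i)) 0 with hi | hi
    · have := (le_div_iff₀ (by linarith)).1 (hmin i hi)
      linarith
    · have := mul_nonneg hs0 hi
      have := hφ i
      linarith
  have hsub : zeros φ ⊂ zeros (φ + s • χ) := by
    refine Finset.ssubset_iff_subset_ne.2 ⟨fun i hi => ?_, fun heq => ?_⟩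
    · have hi : φ (a i) = 0 := by simpa [zeros] using hi
      simp [zeros, hi, hχ0 i hi]
    · have : l ∈ zeros (φ + s • χ) := by
        have : χ (a l) ≠ 0 := hl.ne
        simp only [zeros, Finset.mem_filter, Finset.mem_univ, true_and, LinearMap.add_apply,
          LinearMap.smul_apply, smul_eq_mul, hs]
        field_simp
        ring
      rw [← heq] at this
      have hl0 : φ (a l) = 0 := by simpa [zeros] using this
      exact hl.ne (hχ0 l hl0)
  exact absurd (Finset.card_lt_card hsub) (not_lt.2 (hmax _ hmem))

/-- Any family whose image of `s` has span of dimension at least `k` contains a `k`-element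
linearly independent subfamily. -/
theorem exists_subset_card_eq_finrank_span {V ι : Type*} [AddCommGroup V] [Module ℝ V]
    [FiniteDimensional ℝ V] [Fintype ι] (a : ι → V) (s : Set ι) {k : ℕ}
    (hk : k ≤ finrank ℝ (Submodule.span ℝ (a '' s))) :
    ∃ J : Finset ι, ↑J ⊆ s ∧ J.card = k ∧ finrank ℝ (Submodule.span ℝ (a '' (J : Set ι))) = k := by
  classical
  obtain ⟨b, hbs, -, hspan, hli⟩ := exists_linearIndepOn_extension
    (linearIndepOn_empty ℝ a) (Set.empty_subset s)
  have hfin : b.Finite := Set.toFinite b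
  have heq : Submodule.span ℝ (a '' b) = Submodule.span ℝ (a '' s) :=
    le_antisymm (Submodule.span_mono (Set.image_mono hbs)) (Submodule.span_le.2 hspan)
  have hrank : ∀ c : Finset ι, (c : Set ι) ⊆ b →
      finrank ℝ (Submodule.span ℝ (a '' (c : Set ι))) = c.card := by
    intro c hc
    have h := finrank_span_eq_card (hli.mono hc)
    rw [Set.image_eq_range]
    simpa using h
  have hb := hrank hfin.toFinset (by simp)
  rw [hfin.coe_toFinset, heq] at hb
  obtain ⟨J, hJ, hJk⟩ := Finset.exists_subset_card_eq (hb ▸ hk)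
  have hJb : (J : Set ι) ⊆ b := fun i hi => hfin.mem_toFinset.1 (hJ hi)
  exact ⟨J, hJb.trans hbs, hJk, (hrank J hJb).trans hJk⟩

/-- The cone generated by a finite spanning family of `m` vectors in dimension `t` is cut out by
at most `m.choose (t - 1)` facet inequalities. -/
theorem exists_facet_functionals {V ι : Type*} [AddCommGroup V] [Module ℝ V]
    [FiniteDimensional ℝ V] [Fintype ι] (a : ι → V) (ha : Submodule.span ℝ (Set.range a) = ⊤) :
    ∃ F : Finset (Dual ℝ V), F.card ≤ (Fintype.card ι).choose (finrank ℝ V - 1) ∧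
      (∀ φ ∈ F, ∀ i, 0 ≤ φ (a i)) ∧
      ∀ x, (∃ φ : Dual ℝ V, (∀ i, 0 ≤ φ (a i)) ∧ φ x < 0) → ∃ φ ∈ F, φ x < 0 := by
  classical
  let facet (J : Finset ι) (φ : Dual ℝ V) : Prop :=
    (∀ i, 0 ≤ φ (a i)) ∧ φ ≠ 0 ∧ ∀ i ∈ J, φ (a i) = 0
  let g : Finset ι → Dual ℝ V := fun J => if h : ∃ φ, facet J φ then h.choose else 0
  have hg : ∀ J φ, facet J φ → facet J (g J) := fun J φ h => by
    have h' : ∃ φ, facet J φ := ⟨φ, h⟩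
    simpa only [g, dif_pos h'] using h'.choose_spec
  refine ⟨(Finset.univ.powersetCard (finrank ℝ V - 1)).image g, ?_, ?_, ?_⟩
  · exact Finset.card_image_le.trans (by simp)
  · intro φ hφ i
    obtain ⟨J, -, rfl⟩ := Finset.mem_image.1 hφ
    by_cases h : ∃ φ, facet J φ
    · exact (hg J _ h.choose_spec).1 i
    · simp [g, dif_neg h]
  · rintro x ⟨φ₀, h₀, hx₀⟩
    obtain ⟨φ, hφ, hφx, hrank⟩ := exists_nonneg_functional_finrank_zeros a ha x φ₀ h₀ hx₀
    obtain ⟨J, hJ, hJc, hJr⟩ := exists_subset_card_eq_finrank_span a {i | φ (a i) = 0}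
      (k := finrank ℝ V - 1) (by omega)
    have hφ0 : φ ≠ 0 := by rintro rfl; simp at hφx
    obtain ⟨hg1, hg2, hg3⟩ := hg J φ ⟨hφ, hφ0, fun i hi => hJ hi⟩
    refine ⟨g J, Finset.mem_image_of_mem _ (by simp [hJc]), ?_⟩
    set Z := Submodule.span ℝ (a '' (J : Set ι))
    have hann : ∀ ψ : Dual ℝ V, (∀ i ∈ J, ψ (a i) = 0) → ψ ∈ Z.dualAnnihilator := by
      intro ψ hψ
      rw [Submodule.mem_dualAnnihilator]
      have : Z ≤ LinearMap.ker ψ := Submodule.span_le.2 (by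
        rintro _ ⟨i, hi, rfl⟩
        exact hψ i hi)
      exact fun w hw => this hw
    -- `J` spans a hyperplane, so `φ` and the chosen `g J` are proportional; nonnegativity on the
    -- generators makes the factor positive.
    have hone : finrank ℝ Z.dualAnnihilator ≤ 1 := by
      have := Subspace.finrank_add_finrank_dualAnnihilator_eq Z
      omega
    obtain ⟨v, hv⟩ := exists_forall_smul_eq_of_finrank_le_one _ hone
    obtain ⟨c, hc⟩ := hv φ (hann φ fun i hi => hJ hi)
    obtain ⟨d, hd⟩ := hv (g J) (hann _ hg3)
    have hc0 : c ≠ 0 := by rintro rfl; simp at hc; exact hφ0 hc.symm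
    have hgφ : g J = (d / c) • φ := by
      rw [← hd, ← hc, smul_smul, div_mul_cancel₀ _ hc0]
    have hpos : 0 < d / c := by
      have hne : ∃ i, g J (a i) ≠ 0 := by
        by_contra! hcon
        exact hg2 (LinearMap.ext_on ha (by rintro _ ⟨i, rfl⟩; simpa using hcon i))
      obtain ⟨i, hi⟩ := hne
      have hi' : 0 < g J (a i) := lt_of_le_of_ne (hg1 i) hi.symm
      rw [hgφ, LinearMap.smul_apply, smul_eq_mul] at hi'
      exact pos_of_mul_pos_left hi' (hφ i)
    rw [hgφ, LinearMap.smul_apply, smul_eq_mul]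
    exact mul_neg_of_pos_of_neg hpos hφx

/-- The cone generated by finitely many vectors is cut out by its facet inequalities and by pairs
of inequalities for the equations of its linear span. -/
theorem exists_cone_functionals {V ι : Type*} [AddCommGroup V] [Module ℝ V]
    [FiniteDimensional ℝ V] [Fintype ι] (a : ι → V) :
    ∃ F : Finset (Dual ℝ V),
      F.card ≤ (Fintype.card ι).choose (finrank ℝ (Submodule.span ℝ (Set.range a)) - 1) +
        2 * (finrank ℝ V - finrank ℝ (Submodule.span ℝ (Set.range a))) ∧
      (∀ φ ∈ F, ∀ i, 0 ≤ φ (a i)) ∧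
      ∀ x, (∃ φ : Dual ℝ V, (∀ i, 0 ≤ φ (a i)) ∧ φ x < 0) → ∃ φ ∈ F, φ x < 0 := by
  classical
  set L := Submodule.span ℝ (Set.range a) with hL
  let a' : ι → L := fun i => ⟨a i, Submodule.subset_span ⟨i, rfl⟩⟩
  have ha' : Submodule.span ℝ (Set.range a') = ⊤ := by
    have := Submodule.span_span_coe_preimage (R := ℝ) (s := Set.range a)
    convert this using 2
    ext ⟨y, hy⟩
    simp [a', Subtype.ext_iff]
  obtain ⟨F₁, hF₁, hnn, hsep⟩ := exists_facet_functionals a' ha'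
  choose ext hext using fun φ : Dual ℝ L => LinearMap.exists_extend (p := L) φ
  have hext' : ∀ (φ : Dual ℝ L) (y : L), ext φ y = φ y := fun φ y =>
    LinearMap.congr_fun (hext φ) y
  obtain ⟨eqs, heqs, hspan⟩ := exists_finset_card_le_finrank_span_eq L.dualAnnihilator
  have hL' := Subspace.finrank_add_finrank_dualAnnihilator_eq L
  have hBa : ∀ χ ∈ eqs, ∀ y ∈ L, χ y = 0 := fun χ hχ => by
    have : χ ∈ L.dualAnnihilator := hspan ▸ Submodule.subset_span hχ
    exact (Submodule.mem_dualAnnihilator _).1 this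
  refine ⟨F₁.image ext ∪ (eqs ∪ eqs.image Neg.neg), ?_, ?_, ?_⟩
  · have h1 := Finset.card_union_le (F₁.image ext) (eqs ∪ eqs.image Neg.neg)
    have h2 := Finset.card_union_le eqs (eqs.image Neg.neg)
    have h3 : (F₁.image ext).card ≤ F₁.card := Finset.card_image_le
    have h4 : (eqs.image Neg.neg).card ≤ eqs.card := Finset.card_image_le
    omega
  · intro φ hφ i
    simp only [Finset.mem_union, Finset.mem_image] at hφ
    have hai : a i ∈ L := (a' i).2
    rcases hφ with ⟨ψ, hψ, rfl⟩ | hχ | ⟨χ, hχ, rfl⟩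
    · exact (hnn ψ hψ i).trans_eq (hext' ψ (a' i)).symm
    · exact (hBa φ hχ _ hai).ge
    · simp [hBa χ hχ _ hai]
  · rintro x ⟨φ, hφ, hφx⟩
    by_cases hx : x ∈ L
    · obtain ⟨ψ, hψ, hψx⟩ := hsep ⟨x, hx⟩ ⟨φ ∘ₗ L.subtype, hφ, hφx⟩
      exact ⟨ext ψ, Finset.mem_union_left _ (Finset.mem_image_of_mem _ hψ),
        (hext' ψ ⟨x, hx⟩).trans_lt hψx⟩
    · have hne : ∃ χ ∈ eqs, χ x ≠ 0 := by
        by_contra! hcon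
        refine hx ((Subspace.forall_mem_dualAnnihilator_apply_eq_zero_iff L x).1 fun χ hχ => ?_)
        rw [← hspan] at hχ
        have hle : Submodule.span ℝ (eqs : Set (Dual ℝ V)) ≤
            LinearMap.ker (Dual.eval ℝ V x) := Submodule.span_le.2 hcon
        exact hle hχ
      obtain ⟨χ, hmem, hj⟩ := hne
      rcases hj.lt_or_gt with hj | hj
      · exact ⟨_, Finset.mem_union_right _ (Finset.mem_union_left _ hmem), hj⟩
      · exact ⟨_, Finset.mem_union_right _ (Finset.mem_union_right _
          (Finset.mem_image_of_mem _ hmem)), by simpa using hj⟩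

/-! ### Binomial estimates -/

theorem le_choose_of_pos_of_lt {n k : ℕ} (hk : 0 < k) (hkn : k < n) : n ≤ n.choose k := by
  induction n generalizing k with
  | zero => omega
  | succ n ih =>
    obtain ⟨k, rfl⟩ : ∃ j, k = j + 1 := ⟨k - 1, by omega⟩
    rw [Nat.choose_succ_succ']
    have h1 : 0 < n.choose k := Nat.choose_pos (by omega)
    rcases Nat.lt_or_ge (k + 1) n with h | h
    · have := ih (k := k + 1) (by omega) h
      omega
    · obtain rfl : n = k + 1 := by omega
      simp

theorem choose_add_three_le_choose_succ {n j : ℕ} (h : 2 * j + 4 ≤ n) :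
    n.choose j + 3 ≤ n.choose (j + 1) := by
  have h1 := Nat.choose_succ_right_eq n j
  have h2 : j + 1 ≤ n.choose j := by
    rcases Nat.eq_zero_or_pos j with rfl | hj
    · simp
    · exact le_trans (by omega) (le_choose_of_pos_of_lt hj (by omega))
  obtain ⟨r, hr⟩ : ∃ r, n - j = j + 1 + 3 + r := ⟨n - j - (j + 1 + 3), by omega⟩
  rw [hr] at h1
  by_contra! hcon
  nlinarith [Nat.zero_le (n.choose j * r)]

/-- Each step from `k` to `d - 1` gains at least 3 and the last at least 1. The total `3 * (d - k) -
2` reaches `2 * (d - k)` once `d - k ≥ 2`. -/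
theorem choose_add_two_mul_le_choose {n d k : ℕ} (hkd : k + 2 ≤ d) (hn : 2 * d ≤ n) :
    n.choose k + 2 * (d - k) ≤ n.choose d := by
  obtain ⟨m, rfl⟩ : ∃ m, d = k + m + 2 := ⟨d - k - 2, by omega⟩
  have h1 : ∀ i ≤ m + 1, n.choose k + 3 * i ≤ n.choose (k + i) := by
    intro i
    induction i with
    | zero => simp
    | succ i ih =>
      intro hi
      have := ih (by omega)
      have := choose_add_three_le_choose_succ (n := n) (j := k + i) (by omega)
      rw [← add_assoc]
      omega
  have h2 := h1 (m + 1) le_rfl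
  have h3 : n.choose (k + (m + 1)) < n.choose (k + m + 2) := by
    have h4 := Nat.choose_succ_right_eq n (k + (m + 1))
    have h5 : 0 < n.choose (k + (m + 1)) := Nat.choose_pos (by omega)
    have h6 : k + (m + 1) + 1 < n - (k + (m + 1)) := by omega
    have h7 := Nat.mul_lt_mul_of_pos_left h6 h5
    rw [← h4] at h7
    exact lt_of_mul_lt_mul_right h7 (Nat.zero_le _)
  omega

/-! ### Polytopes around and inside a convex set -/

theorem setOf_forall_mem_closedConvexPolytopes {C K : ℕ} (F : Finset (Ambient C × ℝ))
    (hF : F.card ≤ K) : {a | ∀ p ∈ F, p.1 ⬝ᵥ a + p.2 ≤ 0} ∈ closedConvexPolytopes C K := by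
  -- Surplus indices carry the vacuous inequality `0 ≤ 0`.
  let p : Fin K → Ambient C × ℝ := fun i =>
    if h : (i : ℕ) < F.card then (F.equivFin.symm ⟨i, h⟩ : Ambient C × ℝ) else 0
  refine ⟨fun i => (p i).1, fun i => (p i).2, ?_⟩
  ext a
  simp only [Set.mem_ofPred_eq]
  constructor
  · intro h i
    by_cases hi : (i : ℕ) < F.card
    · simp only [p, dif_pos hi]
      exact h _ (F.equivFin.symm ⟨i, hi⟩).2
    · simp [p, dif_neg hi]
  · intro h q hq
    have := h ⟨F.equivFin ⟨q, hq⟩, (F.equivFin ⟨q, hq⟩).2.trans_le hF⟩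
    simpa [p] using this

theorem exists_dotProduct_eq {C : ℕ} (φ : Ambient C →ₗ[ℝ] ℝ) :
    ∃ w : Ambient C, ∀ a, φ a = w ⬝ᵥ a := by
  refine ⟨fun i => φ (Pi.single i 1), fun a => ?_⟩
  conv_lhs => rw [LinearMap.pi_apply_eq_sum_univ φ a]
  simp only [dotProduct, smul_eq_mul]
  refine Finset.sum_congr rfl fun i _ => ?_
  rw [mul_comm]
  congr 2
  ext j
  simp [Pi.single_apply, eq_comm]

theorem closedConvexPolytopes_subset (C K : ℕ) :
    closedConvexPolytopes C K ⊆ closedConvexSets C := by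
  rintro _ ⟨w, b, rfl⟩
  rw [Set.ofPred_forall]
  refine ⟨isClosed_iInter fun i => isClosed_le (by fun_prop) continuous_const,
    convex_iInter fun i => ?_⟩
  have hlin : IsLinearMap ℝ fun a : Ambient C => w i ⬝ᵥ a :=
    ⟨fun x y => dotProduct_add _ _ _, fun c x => dotProduct_smul _ _ _⟩
  simpa only [← le_neg_iff_add_nonpos_right] using convex_halfSpace_le hlin (-b i)

/-- A closed convex set can be enlarged to a polytope that avoids the same `n` points. -/
theorem exists_polytope_superset {C n K : ℕ} (p : Fin n → Ambient C) (hK : n ≤ K)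
    {Q : Set (Ambient C)} (hQ : Q ∈ closedConvexSets C) :
    ∃ P ∈ closedConvexPolytopes C K, Q ⊆ P ∧ ∀ i, p i ∈ P ↔ p i ∈ Q := by
  classical
  have hsep : ∀ i, ∃ q : Ambient C × ℝ, (∀ a ∈ Q, q.1 ⬝ᵥ a + q.2 ≤ 0) ∧
      (p i ∉ Q → 0 < q.1 ⬝ᵥ p i + q.2) := by
    intro i
    by_cases hi : p i ∈ Q
    · exact ⟨0, by simp, fun h => absurd hi h⟩
    obtain ⟨φ, u, h1, h2⟩ := geometric_hahn_banach_closed_point hQ.2 hQ.1 hi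
    obtain ⟨w, hw⟩ := exists_dotProduct_eq φ.toLinearMap
    refine ⟨(w, -u), fun a ha => ?_, fun _ => ?_⟩
    · have := h1 a ha
      have := hw a
      simp at this ⊢
      linarith
    · have := hw (p i)
      simp at this ⊢
      linarith
  choose q hq1 hq2 using hsep
  refine ⟨_, setOf_forall_mem_closedConvexPolytopes (Finset.univ.image q)
    (Finset.card_image_le.trans (by simpa using hK)), ?_, fun i => ⟨fun h => ?_, fun h => ?_⟩⟩
  · simp only [Finset.mem_image, Finset.mem_univ, true_and, forall_exists_index,
      forall_apply_eq_imp_iff]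
    exact fun a ha i => hq1 i a ha
  · by_contra hi
    exact absurd (h (q i) (by simp)) (not_le.2 (hq2 i hi))
  · simp only [Finset.mem_image, Finset.mem_univ, true_and, forall_exists_index,
      forall_apply_eq_imp_iff]
    exact fun j => hq1 j _ h

/-- The points `(u, v)` with `∑ u = ∑ v = 1`, lifted to height one, span a space of codimension
at least two. -/
theorem finrank_span_lift_add_two_le {C : ℕ} (hC : 0 < C) {ι : Type*} (p : ι → Ambient C)
    (h₁ : ∀ i, ∑ c, p i (Sum.inl c) = 1) (h₂ : ∀ i, ∑ c, p i (Sum.inr c) = 1) :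
    finrank ℝ (Submodule.span ℝ (Set.range fun i => (p i, (1 : ℝ)))) + 2 ≤ 2 * C + 1 := by
  let g : (Ambient C × ℝ) →ₗ[ℝ] ℝ × ℝ :=
    { toFun := fun z => (∑ c, z.1 (Sum.inl c) - z.2, ∑ c, z.1 (Sum.inr c) - z.2)
      map_add' := fun x y => by
        ext <;> simp [Finset.sum_add_distrib] <;> ring
      map_smul' := fun r x => by
        ext <;> simp [← Finset.mul_sum] <;> ring }
  have hg : Function.Surjective g := by
    rintro ⟨s, t⟩
    refine ⟨(Sum.elim (Pi.single ⟨0, hC⟩ s) (Pi.single ⟨0, hC⟩ t), 0), ?_⟩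
    simp [g]
  have hle : Submodule.span ℝ (Set.range fun i => (p i, (1 : ℝ))) ≤ LinearMap.ker g :=
    Submodule.span_le.2 (by
      rintro _ ⟨i, rfl⟩
      simp [g, h₁, h₂])
  have h3 := Submodule.finrank_mono hle
  have h4 := g.finrank_range_add_finrank_ker
  rw [LinearMap.range_eq_top.2 hg, finrank_top] at h4
  simp at h4
  omega

/-- A closed convex set can be shrunk to a polytope that contains the same sample points. -/
theorem exists_polytope_subset {C n : ℕ} (hC : 0 < C) (hn : 4 * C ≤ n) (p : Fin n → Ambient C)
    (h₁ : ∀ i, ∑ c, p i (Sum.inl c) = 1) (h₂ : ∀ i, ∑ c, p i (Sum.inr c) = 1)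
    {Q : Set (Ambient C)} (hQ : Q ∈ closedConvexSets C) :
    ∃ P ∈ closedConvexPolytopes C (n.choose (2 * C)), P ⊆ Q ∧ ∀ i, p i ∈ P ↔ p i ∈ Q := by
  classical
  by_cases hne : ∃ i, p i ∈ Q
  swap
  · push Not at hne
    -- The empty polytope, given by `1 ≤ 0`.
    refine ⟨_, setOf_forall_mem_closedConvexPolytopes {((0 : Ambient C), (1 : ℝ))}
      (Nat.choose_pos (by omega)), fun a ha => ?_, fun i => ?_⟩
    · have := ha (0, 1) (by simp)
      norm_num at this
    · refine ⟨fun h => ?_, fun h => absurd h (hne i)⟩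
      have := h (0, 1) (by simp)
      norm_num at this
  obtain ⟨i₀, hi₀⟩ := hne
  let ι := {i : Fin n // p i ∈ Q}
  let a : ι → Ambient C × ℝ := fun i => (p i, 1)
  obtain ⟨F, hFc, hFa, hFsep⟩ := exists_cone_functionals a
  have hrank := finrank_span_lift_add_two_le hC (fun i : ι => p i) (fun i => h₁ i) (fun i => h₂ i)
  change finrank ℝ (Submodule.span ℝ (Set.range a)) + 2 ≤ _ at hrank
  have hpos : 0 < finrank ℝ (Submodule.span ℝ (Set.range a)) := by
    have : (⟨a ⟨i₀, hi₀⟩, Submodule.subset_span ⟨_, rfl⟩⟩ : Submodule.span ℝ (Set.range a)) ≠ 0 :=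
      fun h => by simpa [a] using congrArg (fun y => y.1.2) h
    exact finrank_pos_iff_exists_ne_zero.2 ⟨_, this⟩
  set t := finrank ℝ (Submodule.span ℝ (Set.range a))
  have hV : finrank ℝ (Ambient C × ℝ) = 2 * C + 1 := by simp; omega
  have hcard : F.card ≤ n.choose (2 * C) := by
    have h1 : (Fintype.card ι).choose (t - 1) ≤ n.choose (t - 1) :=
      Nat.choose_le_choose _ (by simpa using Fintype.card_subtype_le fun i => p i ∈ Q)
    have h2 := choose_add_two_mul_le_choose (n := n) (d := 2 * C) (k := t - 1) (by omega) (by omega)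
    rw [hV] at hFc
    omega
  choose w hw using fun φ : Dual ℝ (Ambient C × ℝ) =>
    exists_dotProduct_eq (φ ∘ₗ LinearMap.inl ℝ (Ambient C) ℝ)
  have hval : ∀ (φ : Dual ℝ (Ambient C × ℝ)) x, φ (x, 1) = w φ ⬝ᵥ x + φ (0, 1) := fun φ x => by
    rw [← hw φ x, LinearMap.comp_apply, LinearMap.inl_apply, ← map_add]
    simp
  refine ⟨_, setOf_forall_mem_closedConvexPolytopes (F.image fun φ => (-w φ, -φ (0, 1)))
    (Finset.card_image_le.trans hcard), ?_⟩
  have hmem : ∀ x, x ∈ {x | ∀ q ∈ F.image (fun φ => (-w φ, -φ (0, 1))), q.1 ⬝ᵥ x + q.2 ≤ 0} ↔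
      ∀ φ ∈ F, 0 ≤ φ (x, 1) := by
    intro x
    simp only [Set.mem_ofPred_eq, Finset.forall_mem_image, neg_dotProduct]
    exact forall₂_congr fun φ _ => by rw [hval φ x]; constructor <;> intro h <;> linarith
  have hsub : ∀ x, (∀ φ ∈ F, 0 ≤ φ (x, 1)) → x ∈ Q := by
    intro x hx
    have hhull : convexHull ℝ (Set.range fun i : ι => p i) ⊆ Q :=
      convexHull_min (by rintro _ ⟨i, rfl⟩; exact i.2) hQ.2
    refine hhull ?_
    by_contra hxh
    obtain ⟨φ, u, hu1, hu2⟩ := geometric_hahn_banach_closed_point (convex_convexHull ℝ _)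
      ((Set.finite_range fun i : ι => p i).isClosed_convexHull ℝ) hxh
    obtain ⟨ψ, hψ, hψx⟩ := hFsep (x, 1)
      -- The affine function `u - φ` separating `x` from the hull, homogenised by the height
      -- coordinate.
      ⟨u • LinearMap.snd ℝ (Ambient C) ℝ - φ.toLinearMap ∘ₗ LinearMap.fst ℝ (Ambient C) ℝ,
        fun i => by
          have := hu1 _ (subset_convexHull ℝ _ ⟨i, rfl⟩)
          simp [a]
          linarith,
        by simpa using hu2⟩
    exact absurd (hx ψ hψ) (not_le.2 hψx)
  exact ⟨fun x hx => hsub x ((hmem x).1 hx), fun i =>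
    ⟨fun h => hsub _ ((hmem _).1 h), fun h => (hmem _).2 fun φ hφ => hFa φ hφ ⟨i, h⟩⟩⟩

/-! ### Comparing discrepancies -/

theorem sampleProb_congr {X : Type*} {C n : ℕ} (f : X → Fin C → ℝ) (S : Fin n → X × Fin C)
    {P Q : Set (Ambient C)} (h : ∀ i, feature f (S i) ∈ P ↔ feature f (S i) ∈ Q) :
    sampleProb f S P = sampleProb f S Q := by
  simp only [sampleProb, h]

theorem distProb_mono {X : Type*} [MeasurableSpace X] {C : ℕ} (f : X → Fin C → ℝ)
    (𝒟 : Measure (X × Fin C)) [IsProbabilityMeasure 𝒟] {P Q : Set (Ambient C)} (h : P ⊆ Q) :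
    distProb f 𝒟 P ≤ distProb f 𝒟 Q :=
  measureReal_mono fun _ hz => h hz

theorem discrepancyOn_le_one {X : Type*} [MeasurableSpace X] {C n : ℕ} (f : X → Fin C → ℝ)
    (S : Fin n → X × Fin C) (𝒟 : Measure (X × Fin C)) [IsProbabilityMeasure 𝒟]
    (Q : Set (Ambient C)) : discrepancyOn f S 𝒟 Q ≤ 1 := by
  have h1 : 0 ≤ distProb f 𝒟 Q := measureReal_nonneg
  have h2 : distProb f 𝒟 Q ≤ 1 := measureReal_le_one
  have h3 : 0 ≤ sampleProb f S Q := by unfold sampleProb; positivity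
  have h4 : sampleProb f S Q ≤ 1 := by
    refine div_le_one_of_le₀ ?_ (Nat.cast_nonneg n)
    exact_mod_cast (Finite.card_subtype_le _).trans_eq (Nat.card_fin n)
  exact abs_le.2 ⟨by linarith, by linarith⟩

end CvxDiscrepancy

theorem proposition2 {X : Type*} [MeasurableSpace X] (C n : ℕ)
    (f : X → Fin C → ℝ) (hf : Measurable f) (hfΔ : ∀ x, f x ∈ stdSimplex ℝ (Fin C))
    (𝒟 : Measure (X × Fin C)) [IsProbabilityMeasure 𝒟]
    (S : Fin n → X × Fin C) (hn : 4 * C ≤ n) :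
    CvxDiscrepancy.discrepancy f S 𝒟 (CvxDiscrepancy.closedConvexSets C) =
      CvxDiscrepancy.discrepancy f S 𝒟
        (CvxDiscrepancy.closedConvexPolytopes C (n.choose (2 * C))) := by
  have hC : 0 < C := by
    obtain ⟨z⟩ := nonempty_of_isProbabilityMeasure 𝒟
    exact z.2.pos
  have hbdd : ∀ 𝒬 : Set (Set (CvxDiscrepancy.Ambient C)),
      BddAbove (CvxDiscrepancy.discrepancyOn f S 𝒟 '' 𝒬) := fun 𝒬 =>
    ⟨1, by rintro _ ⟨Q, -, rfl⟩; exact CvxDiscrepancy.discrepancyOn_le_one f S 𝒟 Q⟩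
  apply le_antisymm
  · refine csSup_le ⟨_, ∅, ⟨isClosed_empty, convex_empty⟩, rfl⟩ ?_
    rintro _ ⟨Q, hQ, rfl⟩
    suffices h : ∃ P ∈ CvxDiscrepancy.closedConvexPolytopes C (n.choose (2 * C)),
        CvxDiscrepancy.discrepancyOn f S 𝒟 Q ≤ CvxDiscrepancy.discrepancyOn f S 𝒟 P by
      obtain ⟨P, hP, hle⟩ := h
      exact hle.trans (le_csSup (hbdd _) ⟨P, hP, rfl⟩)
    unfold CvxDiscrepancy.discrepancyOn
    -- The sign decides whether losing or gaining `𝒟`-mass widens the gap.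
    rcases le_total (CvxDiscrepancy.distProb f 𝒟 Q) (CvxDiscrepancy.sampleProb f S Q) with h | h
    · obtain ⟨P, hP, hsub, hiff⟩ := CvxDiscrepancy.exists_polytope_subset hC hn
        (fun i => CvxDiscrepancy.feature f (S i))
        (fun i => by simpa [CvxDiscrepancy.feature] using (hfΔ (S i).1).2)
        (fun i => by simp [CvxDiscrepancy.feature]) hQ
      refine ⟨P, hP, ?_⟩
      rw [CvxDiscrepancy.sampleProb_congr f S hiff, abs_of_nonneg (by linarith)]
      have := CvxDiscrepancy.distProb_mono f 𝒟 hsub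
      exact le_trans (by linarith) (le_abs_self _)
    · obtain ⟨P, hP, hsub, hiff⟩ := CvxDiscrepancy.exists_polytope_superset
        (fun i => CvxDiscrepancy.feature f (S i))
        (CvxDiscrepancy.le_choose_of_pos_of_lt (n := n) (k := 2 * C) (by omega) (by omega)) hQ
      refine ⟨P, hP, ?_⟩
      rw [CvxDiscrepancy.sampleProb_congr f S hiff, abs_of_nonpos (by linarith)]
      have := CvxDiscrepancy.distProb_mono f 𝒟 hsub
      exact le_trans (by linarith) (neg_le_abs _)
  · exact csSup_le_csSup (hbdd _)
      (Set.Nonempty.image _ ⟨_, CvxDiscrepancy.setOf_forall_mem_closedConvexPolytopes ∅ (by simp)⟩)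
      (Set.image_mono (CvxDiscrepancy.closedConvexPolytopes_subset C _))
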